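/- Let $\varphi:\mathbb R^n\to\mathbb R$ and $f:\mathbb R^n\to\mathbb R^m$ be twice differentiable at $\bar x\in\mathbb R^n$, let $\Theta\subset\mathbb R^m$ be closed and convex, and put $L(x,\lambda)=\varphi(x)+\langle\lambda,f(x)\rangle$ and, for $\rho>0$, $$\mathcal L(x,\lambda,\rho)=\varphi(x)+\tfrac{\rho}{2}\Big[\mathrm{dist}\big(f(x)+\rho^{-1}\lambda;\Theta\big)^2-\|\rho^{-1}\lambda\|^2\Big].$$ **Notation.** For a set $\Omega$, $\delta_\Omega$ is its indicator function ($0$ on $\Omega$, $+\infty$ outside), and for $x\in\Omega$, $T_\Omega(x)$ is the set of $w$ for which there are $t_k\downarrow0$, $w_k\to w$ with $x+t_kw_k\in\Omega$; $T^2_\Omega(x,w)$ is the set of $z$ for which there are $t_k\downarrow0$, $z_k\to z$ with $x+t_kw+\frac12t_k^2z_k\in\Omega$; $N_\Omega(x)$ is the limiting normal cone, which for convex $\Omega$ is the normal cone of convex analysis (empty if $x\notin\Omega$); and $K_\Omega(x,v)=T_\Omega(x)\cap\{v\}^\perp$. For $\psi$ with values in $[-\infty,\infty]$ and finite at $x$,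 put $$\Delta_t^2\psi(x,v)(u)=\frac{\psi(x+tu)-\psi(x)-t\langle v,u\rangle}{\frac12t^2},\qquad \mathrm d^2\psi(x,v)(w)=\liminf_{t\downarrow0,\,u\to w}\Delta_t^2\psi(x,v)(u),$$ the latter being the second subderivative; $\psi$ is twice epi-differentiable at $x$ for $v$ if the epigraph of $\mathrm d^2\psi(x,v)$ is closed and, as $t\downarrow0$, the distance functions of the epigraphs of $\Delta^2_t\psi(x,v)$ converge pointwise to that of the epigraph of $\mathrm d^2\psi(x,v)$. The Moreau envelope is $e_r\psi(x)=\inf_w\{\psi(w)+\frac1{2r}\|w-x\|^2\}$. The set $\Omega$ is parabolically derivable at $x$ for $w$ if $T^2_\Omega(x,w)\neq\emptyset$ and for each $z\in T^2_\Omega(x,w)$ there are $\varepsilon>0$ and $\xi:[0,\varepsilon]\to\Omega$ with $\xi(0)=x$, $\frac{\xi(t)-x}{t}\to w$ and $\frac{\xi(t)-x-tw}{\frac12t^2}\to z$ as $t\downarrow0$. It is parabolically regular at $x\in\Omega$ for $v$ if for every $w$ with $\mathrm d^2\delta_\Omega(x,v)(w)<\infty$ there are $t_k\downarrow0$, $w_k\to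 w$ with $\Delta^2_{t_k}\delta_\Omega(x,v)(w_k)\to\mathrm d^2\delta_\Omega(x,v)(w)$ and $\limsup_k\|w_k-w\|/t_k<\infty$. A function $g:\mathbb R^n\to\mathbb R$ is twice semidifferentiable at $x$ if for every $w$ the finite limits $$\mathrm dg(x)(w)=\lim_{t\downarrow0,\,u\to w}\frac{g(x+tu)-g(x)}{t},\qquad \mathrm d^2g(x)(w)=\lim_{t\downarrow0,\,u\to w}\frac{g(x+tu)-g(x)-t\,\mathrm dg(x)(u)}{\frac12t^2}$$ exist; $\mathrm d^2g(x)$ is its second semiderivative. **Theorem 8.3.** Let $\bar\lambda\in\mathbb R^m$ satisfy $\nabla_xL(\bar x,\bar\lambda)=0$ and $\bar\lambda\in N_\Theta(f(\bar x))$. Assume that $\Theta$ is parabolically derivable at $f(\bar x)$ for every vector of $K_\Theta(f(\bar x),\bar\lambda)$ and parabolically regular at $f(\bar x)$ for $\bar\lambda$. Then for every $\rho>0$ the function $g_\rho:x\mapsto\mathcal L(x,\bar\lambda,\rho)$ has the following properties. (i) $g_\rho$ is twice semidifferentiable at $\bar x$, and for all $w\in\mathbb R^n$ $$\mathrm d^2g_\rho(\bar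 x)(w)=\langle\nabla^2_{xx}L(\bar x,\bar\lambda)w,w\rangle+e_{1/(2\rho)}\big(\mathrm d^2\delta_\Theta(f(\bar x),\bar\lambda)\big)\big(\nabla f(\bar x)w\big).$$ (ii) $\mathcal L(x,\bar\lambda,\rho)=\varphi(\bar x)+\frac12\,\mathrm d^2g_\rho(\bar x)(x-\bar x)+o(\|x-\bar x\|^2)$ as $x\to\bar x$. (iii) $g_\rho$ is twice epi-differentiable at $\bar x$ for $0$, and its second subderivative there satisfies $\mathrm d^2g_\rho(\bar x,0)(w)=\mathrm d^2g_\rho(\bar x)(w)$ for all $w\in\mathbb R^n$. -/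

import Mathlib

open Filter Topology Set Asymptotics
open scoped RealInnerProductSpace ENNReal

noncomputable section

namespace VariationalAnalysis

section Basic

variable {E : Type*} [NormedAddCommGroup E] [InnerProductSpace ℝ E]
variable {F : Type*} [NormedAddCommGroup F] [InnerProductSpace ℝ F]

/-- Classical twice differentiability at a point: the map is differentiable near the point and
its derivative is differentiable at the point. -/
def TwiceDifferentiableAt (g : E → F) (x : E) : Prop :=
  (∀ᶠ y in 𝓝 x, DifferentiableAt ℝ g y) ∧ DifferentiableAt ℝ (fderiv ℝ g) x

/-- The indicator function `δ_Ω`: zero on `Ω` and `+∞` outside `Ω`. -/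
def indicatorFn (Ω : Set E) : E → EReal := fun x =>
  open Classical in if x ∈ Ω then 0 else ⊤

/-- The (Bouligand) tangent cone `T_Ω(x)`. -/
def tangentCone (Ω : Set E) (x : E) : Set E :=
  {w | ∃ (t : ℕ → ℝ) (u : ℕ → E), (∀ k, 0 < t k) ∧ Tendsto t atTop (𝓝 0) ∧
    Tendsto u atTop (𝓝 w) ∧ ∀ k, x + t k • u k ∈ Ω}

/-- The regular (Fréchet) normal cone to `Ω` at `x`; the condition says that the upper limit of
`⟪v, y - x⟫ / ‖y - x‖` as `y → x` within `Ω` is at most zero. It is empty for `x ∉ Ω`. -/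
def regularNormalCone (Ω : Set E) (x : E) : Set E :=
  {v | x ∈ Ω ∧ ∀ ε : ℝ, 0 < ε → ∀ᶠ y in 𝓝[Ω] x, ⟪v, y - x⟫ ≤ ε * ‖y - x‖}

/-- The limiting (Mordukhovich) normal cone `N_Ω(x)`. It is empty for `x ∉ Ω`. -/
def normalCone (Ω : Set E) (x : E) : Set E :=
  {v | x ∈ Ω ∧ ∃ (y : ℕ → E) (u : ℕ → E), Tendsto y atTop (𝓝 x) ∧ Tendsto u atTop (𝓝 v) ∧
    ∀ k, u k ∈ regularNormalCone Ω (y k)}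

/-- The critical cone `K_Ω(x, v) = T_Ω(x) ∩ {v}^⊥`. -/
def criticalCone (Ω : Set E) (x v : E) : Set E :=
  tangentCone Ω x ∩ {w | ⟪v, w⟫ = 0}

/-- The second-order tangent set `T²_Ω(x, w)`. -/
def secondOrderTangentSet (Ω : Set E) (x w : E) : Set E :=
  {z | ∃ (t : ℕ → ℝ) (u : ℕ → E), (∀ k, 0 < t k) ∧ Tendsto t atTop (𝓝 0) ∧
    Tendsto u atTop (𝓝 z) ∧ ∀ k, x + t k • w + ((1 / 2 : ℝ) * t k ^ 2) • u k ∈ Ω}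

/-- Parabolic derivability of `Ω` at `x` for `w`: `T²_Ω(x, w)` is nonempty and each of its
elements `z` is the right second derivative at `0` of an arc `ξ : [0, ε] → Ω` that starts at `x`
with right derivative `w`. -/
def ParabolicallyDerivableAt (Ω : Set E) (x w : E) : Prop :=
  (secondOrderTangentSet Ω x w).Nonempty ∧
  ∀ z ∈ secondOrderTangentSet Ω x w, ∃ ε : ℝ, 0 < ε ∧ ∃ ξ : ℝ → E,
    (∀ t ∈ Icc 0 ε, ξ t ∈ Ω) ∧ ξ 0 = x ∧
    Tendsto (fun t : ℝ => t⁻¹ • (ξ t - ξ 0)) (𝓝[>] 0) (𝓝 w) ∧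
    Tendsto (fun t : ℝ => ((1 / 2 : ℝ) * t ^ 2)⁻¹ • (ξ t - ξ 0 - t • w)) (𝓝[>] 0) (𝓝 z)

/-- The second-order difference quotient
`Δ²_t φ(x, v)(u) = (φ(x + t u) - φ(x) - t ⟪v, u⟫) / (t² / 2)` (used for `t > 0`, `φ x` finite). -/
def diffQuotient₂ (φ : E → EReal) (x v : E) (t : ℝ) (u : E) : EReal :=
  (φ (x + t • u) - φ x - ((t * ⟪v, u⟫ : ℝ) : EReal)) / (((1 / 2 : ℝ) * t ^ 2 : ℝ) : EReal)

/-- The second subderivative `d²φ(x, v)(w)`: the lower limit of `Δ²_t φ(x, v)(u)` as `t ↓ 0`,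
`u → w`. -/
def secondSubderivative (φ : E → EReal) (x v w : E) : EReal :=
  liminf (fun p : ℝ × E => diffQuotient₂ φ x v p.1 p.2) (𝓝[>] (0 : ℝ) ×ˢ 𝓝 w)

/-- Parabolic regularity of `Ω` at `x` for `v`. -/
def ParabolicallyRegularAt (Ω : Set E) (x v : E) : Prop :=
  x ∈ Ω ∧ ∀ w : E, secondSubderivative (indicatorFn Ω) x v w < ⊤ →
    ∃ (t : ℕ → ℝ) (u : ℕ → E), (∀ k, 0 < t k) ∧ Tendsto t atTop (𝓝 0) ∧
      Tendsto u atTop (𝓝 w) ∧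
      Tendsto (fun k => diffQuotient₂ (indicatorFn Ω) x v (t k) (u k)) atTop
        (𝓝 (secondSubderivative (indicatorFn Ω) x v w)) ∧
      limsup (fun k => ((‖u k - w‖ / t k : ℝ) : EReal)) atTop < ⊤

/-- Convergence, as `t ↓ 0`, of a family of sets `S t` to a set `S₀`: the limit set is closed and
the distance functions converge pointwise (the distance to the empty set is `∞`). -/
def SetsConverge {X : Type*} [PseudoEMetricSpace X] (S : ℝ → Set X) (S₀ : Set X) : Prop :=
  IsClosed S₀ ∧
    ∀ p : X, Tendsto (fun t => Metric.infEDist p (S t)) (𝓝[>] 0) (𝓝 (Metric.infEDist p S₀))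

/-- The epigraph of an extended-real-valued function, as a subset of `E × ℝ` with its Euclidean
(`ℓ²`) product metric. -/
def epigraph (φ : E → EReal) : Set (WithLp 2 (E × ℝ)) :=
  {p | φ p.fst ≤ ((p.snd : ℝ) : EReal)}

/-- Twice epi-differentiability of `φ` at `x` for `v`. -/
def TwiceEpiDifferentiableAt (φ : E → EReal) (x v : E) : Prop :=
  SetsConverge (fun t => epigraph (diffQuotient₂ φ x v t)) (epigraph (secondSubderivative φ x v))

/-- Semidifferentiability at `x` of a real-valued function. -/
def SemidifferentiableAt (g : E → ℝ) (x : E) : Prop :=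
  ∀ w : E, ∃ l : ℝ,
    Tendsto (fun p : ℝ × E => (g (x + p.1 • p.2) - g x) / p.1) (𝓝[>] (0 : ℝ) ×ˢ 𝓝 w) (𝓝 l)

/-- The semiderivative `dg(x)(w)` (meaningful for semidifferentiable `g`). -/
def semiderivative (g : E → ℝ) (x w : E) : ℝ :=
  limUnder (𝓝[>] (0 : ℝ) ×ˢ 𝓝 w) (fun p : ℝ × E => (g (x + p.1 • p.2) - g x) / p.1)

/-- The quotient `Δ²_t g(x)(u) = (g(x + t u) - g(x) - t dg(x)(u)) / (t² / 2)`. -/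
def semiDiffQuotient₂ (g : E → ℝ) (x : E) (t : ℝ) (u : E) : ℝ :=
  (g (x + t • u) - g x - t * semiderivative g x u) / ((1 / 2 : ℝ) * t ^ 2)

/-- Twice semidifferentiability at `x` of a real-valued function. -/
def TwiceSemidifferentiableAt (g : E → ℝ) (x : E) : Prop :=
  SemidifferentiableAt g x ∧ ∀ w : E, ∃ l : ℝ,
    Tendsto (fun p : ℝ × E => semiDiffQuotient₂ g x p.1 p.2) (𝓝[>] (0 : ℝ) ×ˢ 𝓝 w) (𝓝 l)

/-- The second semiderivative `d²g(x)(w)` (meaningful for twice semidifferentiable `g`). -/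
def secondSemiderivative (g : E → ℝ) (x w : E) : ℝ :=
  limUnder (𝓝[>] (0 : ℝ) ×ˢ 𝓝 w) (fun p : ℝ × E => semiDiffQuotient₂ g x p.1 p.2)

/-- The Moreau envelope `e_r ψ(x) = inf_w (ψ(w) + ‖w - x‖² / (2r))`. -/
def moreauEnvelope (r : ℝ) (ψ : E → EReal) (x : E) : EReal :=
  ⨅ w : E, ψ w + ((1 / (2 * r) * ‖w - x‖ ^ 2 : ℝ) : EReal)

/-- The Lagrangian `L(x, μ) = φ(x) + ⟪μ, f(x)⟫` of the problem of minimizing `φ(x)` subject to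
`f(x) ∈ Θ`. -/
def lagrangian (φ : E → ℝ) (f : E → F) (x : E) (μ : F) : ℝ :=
  φ x + ⟪μ, f x⟫

/-- The augmented Lagrangian
`𝓛(x, μ, ρ) = φ(x) + (ρ / 2) (dist(f(x) + ρ⁻¹ μ; Θ)² - ‖ρ⁻¹ μ‖²)`. -/
def augmentedLagrangian (φ : E → ℝ) (f : E → F) (Θ : Set F) (x : E) (μ : F) (ρ : ℝ) : ℝ :=
  φ x + ρ / 2 * (Metric.infDist (f x + ρ⁻¹ • μ) Θ ^ 2 - ‖ρ⁻¹ • μ‖ ^ 2)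

end Basic

end VariationalAnalysis

end

open VariationalAnalysis

/-!
Write `z = f x̄`, and let `q t = Δ²_t δ_Θ(z, λ)` be the second-order quotients of the indicator
function. Since `λ` is normal to the convex set `Θ` at `z`, they are nonnegative and vanish at `0`.
Completing the square in the squared distance shows that the nonsmooth part of the augmented
Lagrangian has as its second-order quotient at `z` for `λ` (`penaltyQuotient`) exactly the Moreau
envelope `e_{1/(2ρ)} (q t)`; consequently
`𝓛(x̄ + t u) - 𝓛(x̄) = L(x̄ + t u) - L(x̄) + (t² / 2) e_{1/(2ρ)} (q t) ((f (x̄ + t u) - z) / t)`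
(`augmentedLagrangian_quotient_eq`). As `∇ₓL(x̄, λ) = 0`, the smooth part contributes the Hessian of
`L` by Taylor's formula, and the matter is the convergence of the envelopes as `t ↓ 0`, `u → w`
(`tendsto_penaltyQuotient`).

* Lower bound (`eventually_lt_penaltyQuotient`): by nonnegativity of `q t`, minimizers stay in a
  fixed ball, where the lower limit defining `d²δ_Θ(z, λ)` is uniform by compactness.
* Upper bound (`eventually_penaltyQuotient_lt`): each `w` with `d²δ_Θ(z, λ)(w)` finite is the limit
  of a family `η t` along which `q t` converges to that value (`exists_recovery_family`). This is
  where parabolic regularity and parabolic derivability enter.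

So the quotients `(𝓛(x̄ + t u) - 𝓛(x̄)) / (t² / 2)` converge continuously, as `t ↓ 0` and `u → w`, to a
finite function of `w` (`HasSecondOrderLimit`). All the assertions follow from this property: the
first semiderivative is zero, the limit is the second semiderivative and the second subderivative,
it is continuous and positively homogeneous of degree two, so that convergence on the compact unit
sphere gives the expansion, and continuous convergence entails convergence of the epigraphs.
-/

namespace VariationalAnalysis

/-! ### Compactness along a product filter -/

/-- A property that holds eventually along `l ×ˢ 𝓝 y` for every `y` in a compact set holds,
eventually along `l`, at all points of this set simultaneously. -/
lemma eventually_forall_of_isCompact {X Y : Type*} [TopologicalSpace Y] {l : Filter X} {K : Set Y}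
    (hK : IsCompact K) {P : X × Y → Prop} (h : ∀ y ∈ K, ∀ᶠ p in l ×ˢ 𝓝 y, P p) :
    ∀ᶠ x in l, ∀ y ∈ K, P (x, y) := by
  have h' : ∀ᶠ p in l ×ˢ 𝓝ˢ K, P p := hK.mem_prod_nhdsSet_of_forall h
  exact h'.curry.mono fun x hx => hx.self_of_nhdsSet

section Cone

variable {F : Type*} [NormedAddCommGroup F] [InnerProductSpace ℝ F]

/-! ### Normals to a convex set -/

lemma inner_sub_nonpos_of_mem_regularNormalCone {Θ : Set F} (hΘ : Convex ℝ Θ) {x v y : F}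
    (hv : v ∈ regularNormalCone Θ x) (hy : y ∈ Θ) : ⟪v, y - x⟫ ≤ 0 := by
  obtain ⟨hx, h⟩ := hv
  have hpath : Tendsto (fun s : ℝ => x + s • (y - x)) (𝓝[>] 0) (𝓝[Θ] x) := by
    refine tendsto_nhdsWithin_iff.2 ⟨?_, ?_⟩
    · have : Tendsto (fun s : ℝ => x + s • (y - x)) (𝓝 0) (𝓝 (x + (0 : ℝ) • (y - x))) :=
        Continuous.tendsto (by fun_prop) 0
      simpa using this.mono_left nhdsWithin_le_nhds
    · filter_upwards [Ioo_mem_nhdsGT (zero_lt_one (α := ℝ))] with s hs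
      exact hΘ.add_smul_sub_mem hx hy ⟨hs.1.le, hs.2.le⟩
  have key : ∀ ε : ℝ, 0 < ε → ⟪v, y - x⟫ ≤ ε * ‖y - x‖ := by
    intro ε hε
    obtain ⟨s, hs, hs0⟩ := ((hpath.eventually (h ε hε)).and self_mem_nhdsWithin).exists
    have hs0 : (0 : ℝ) < s := hs0
    rw [add_sub_cancel_left, inner_smul_right, norm_smul, Real.norm_of_nonneg hs0.le] at hs
    nlinarith
  have hlim : Tendsto (fun ε : ℝ => ε * ‖y - x‖) (𝓝[>] 0) (𝓝 0) := by
    have : Tendsto (fun ε : ℝ => ε * ‖y - x‖) (𝓝 0) (𝓝 (0 * ‖y - x‖)) :=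
      Continuous.tendsto (by fun_prop) 0
    simpa using this.mono_left nhdsWithin_le_nhds
  exact ge_of_tendsto hlim (eventually_nhdsWithin_of_forall key)

/-- For a convex set the limiting normals are the normals of convex analysis. -/
lemma inner_sub_nonpos_of_mem_normalCone {Θ : Set F} (hΘ : Convex ℝ Θ) {x v y : F}
    (hv : v ∈ normalCone Θ x) (hy : y ∈ Θ) : ⟪v, y - x⟫ ≤ 0 := by
  obtain ⟨-, a, u, ha, hu, hn⟩ := hv
  have hlim : Tendsto (fun k => ⟪u k, y - a k⟫) atTop (𝓝 ⟪v, y - x⟫) :=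
    hu.inner (tendsto_const_nhds.sub ha)
  exact le_of_tendsto hlim
    (Eventually.of_forall fun k => inner_sub_nonpos_of_mem_regularNormalCone hΘ (hn k) hy)

/-! ### Second-order quotients of the indicator function -/

lemma diffQuotient₂_indicatorFn_of_mem {Θ : Set F} {x v w : F} {t : ℝ} (hx : x ∈ Θ)
    (hw : x + t • w ∈ Θ) :
    diffQuotient₂ (indicatorFn Θ) x v t w = ((-(t * ⟪v, w⟫) / (1 / 2 * t ^ 2) : ℝ) : EReal) := by
  rw [diffQuotient₂, indicatorFn, indicatorFn, if_pos hx, if_pos hw, EReal.coe_div, EReal.coe_neg]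
  simp

lemma diffQuotient₂_indicatorFn_of_notMem {Θ : Set F} {x v w : F} {t : ℝ} (ht : 0 < t)
    (hx : x ∈ Θ) (hw : x + t • w ∉ Θ) : diffQuotient₂ (indicatorFn Θ) x v t w = ⊤ := by
  have hpos : 0 < (1 / 2 : ℝ) * t ^ 2 := by positivity
  rw [diffQuotient₂, indicatorFn, indicatorFn, if_pos hx, if_neg hw, sub_zero, EReal.top_sub_coe]
  exact EReal.top_div_of_pos_ne_top (by exact_mod_cast hpos) (EReal.coe_ne_top _)

lemma diffQuotient₂_indicatorFn_nonneg {Θ : Set F} {x v w : F} {t : ℝ} (ht : 0 < t) (hx : x ∈ Θ)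
    (hv : ∀ y ∈ Θ, ⟪v, y - x⟫ ≤ 0) : 0 ≤ diffQuotient₂ (indicatorFn Θ) x v t w := by
  by_cases hw : x + t • w ∈ Θ
  · rw [diffQuotient₂_indicatorFn_of_mem hx hw]
    have h := hv _ hw
    rw [add_sub_cancel_left, inner_smul_right] at h
    have : 0 ≤ -(t * ⟪v, w⟫) / (1 / 2 * t ^ 2) := div_nonneg (by linarith) (by positivity)
    exact_mod_cast this
  · rw [diffQuotient₂_indicatorFn_of_notMem ht hx hw]
    exact le_top

lemma eventually_pos_fst {Y : Type*} (l : Filter Y) :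
    ∀ᶠ p : ℝ × Y in 𝓝[>] (0 : ℝ) ×ˢ l, 0 < p.1 :=
  tendsto_fst.eventually self_mem_nhdsWithin

lemma secondSubderivative_indicatorFn_nonneg {Θ : Set F} {x v : F} (hx : x ∈ Θ)
    (hv : ∀ y ∈ Θ, ⟪v, y - x⟫ ≤ 0) (w : F) : 0 ≤ secondSubderivative (indicatorFn Θ) x v w :=
  le_liminf_of_le (h := (eventually_pos_fst (𝓝 w)).mono fun _ hp =>
    diffQuotient₂_indicatorFn_nonneg hp hx hv)

lemma secondSubderivative_indicatorFn_zero {Θ : Set F} {x v : F} (hx : x ∈ Θ)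
    (hv : ∀ y ∈ Θ, ⟪v, y - x⟫ ≤ 0) : secondSubderivative (indicatorFn Θ) x v 0 = 0 := by
  refine le_antisymm ?_ (secondSubderivative_indicatorFn_nonneg hx hv 0)
  refine liminf_le_of_frequently_le ?_
  have h0 : Tendsto (fun t : ℝ => (t, (0 : F))) (𝓝[>] 0) (𝓝[>] (0 : ℝ) ×ˢ 𝓝 (0 : F)) :=
    tendsto_id.prodMk tendsto_const_nhds
  refine h0.frequently (Frequently.of_forall fun t => ?_)
  rw [diffQuotient₂_indicatorFn_of_mem hx (by simpa using hx)]
  simp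

/-! ### Recovery families -/

/-- Parabolic regularity yields a sequence `u k → w` along which the quotients converge to the
second subderivative and which approaches `w` at the rate `t k`; so its second-order parts have a
cluster point `z ∈ T²_Θ(x, w)`, and the second subderivative equals `-⟪v, z⟫`. Parabolic
derivability replaces the sequence by an arc with the same `z`, hence by a family defined for all
small `t`. -/
lemma exists_recovery_family [ProperSpace F] {Θ : Set F} {x v w : F} {c : ℝ} (hx : x ∈ Θ)
    (hder : ∀ u ∈ criticalCone Θ x v, ParabolicallyDerivableAt Θ x u)
    (hreg : ParabolicallyRegularAt Θ x v)
    (hc : secondSubderivative (indicatorFn Θ) x v w = (c : EReal)) :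
    ∃ η : ℝ → F, Tendsto η (𝓝[>] 0) (𝓝 w) ∧ (∀ᶠ t in 𝓝[>] (0 : ℝ), x + t • η t ∈ Θ) ∧
      Tendsto (fun t => -(t * ⟪v, η t⟫) / (1 / 2 * t ^ 2)) (𝓝[>] 0) (𝓝 c) := by
  obtain ⟨t, u, ht, ht0, hu, hq, hb⟩ := hreg.2 w (hc ▸ EReal.coe_lt_top c)
  rw [hc] at hq
  obtain ⟨C, hC, -⟩ := EReal.lt_iff_exists_real_btwn.1 hb
  have hbound : ∀ᶠ k in atTop, ‖u k - w‖ / t k < C :=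
    (eventually_lt_of_limsup_lt hC).mono fun k hk => by exact_mod_cast hk
  have hmem : ∀ᶠ k in atTop, x + t k • u k ∈ Θ := by
    filter_upwards [(tendsto_order.1 hq).2 ⊤ (EReal.coe_lt_top c)] with k hk
    by_contra hk'
    exact hk.ne (diffQuotient₂_indicatorFn_of_notMem (ht k) hx hk')
  obtain ⟨N, hN⟩ := eventually_atTop.1 (hbound.and hmem)
  set z : ℕ → F := fun k => (2 / t k) • (u k - w) with hz
  have hzb : ∀ k, z (k + N) ∈ Metric.closedBall (0 : F) (2 * C) := by
    intro k
    have h1 := (hN (k + N) (by omega)).1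
    rw [mem_closedBall_zero_iff, hz, norm_smul,
      Real.norm_of_nonneg (by have := ht (k + N); positivity)]
    calc 2 / t (k + N) * ‖u (k + N) - w‖ = 2 * (‖u (k + N) - w‖ / t (k + N)) := by ring
      _ ≤ 2 * C := by linarith
  obtain ⟨z₀, -, ψ, hψ, hzψ⟩ := tendsto_subseq_of_bounded Metric.isBounded_closedBall hzb
  set κ : ℕ → ℕ := fun k => ψ k + N with hκdef
  have hκ : Tendsto κ atTop atTop := (tendsto_add_atTop_nat N).comp hψ.tendsto_atTop
  have hκmem : ∀ k, x + t (κ k) • u (κ k) ∈ Θ := fun k => (hN (κ k) (by simp [hκdef])).2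
  have hqκ : Tendsto (fun k => -(t (κ k) * ⟪v, u (κ k)⟫) / (1 / 2 * t (κ k) ^ 2)) atTop (𝓝 c) := by
    rw [← EReal.tendsto_coe]
    refine (hq.comp hκ).congr fun k => ?_
    exact diffQuotient₂_indicatorFn_of_mem hx (hκmem k)
  have hvw : ⟪v, w⟫ = 0 := by
    have h1 : Tendsto (fun k => ⟪v, u (κ k)⟫) atTop (𝓝 ⟪v, w⟫) :=
      tendsto_const_nhds.inner (hu.comp hκ)
    have h2 := ((ht0.comp hκ).mul hqκ).const_mul (-1 / 2)
    refine tendsto_nhds_unique h1 ?_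
    have h3 : (-1 / 2 : ℝ) * (0 * c) = 0 := by ring
    rw [h3] at h2
    refine h2.congr fun k => ?_
    have := (ht (κ k)).ne'
    simp only [Function.comp]
    field_simp
  have hcrit : w ∈ criticalCone Θ x v :=
    ⟨⟨t ∘ κ, u ∘ κ, fun k => ht _, ht0.comp hκ, hu.comp hκ, hκmem⟩, hvw⟩
  have hz₀ : z₀ ∈ secondOrderTangentSet Θ x w := by
    refine ⟨t ∘ κ, z ∘ κ, fun k => ht _, ht0.comp hκ, hzψ, fun k => ?_⟩
    have h1 : x + (t ∘ κ) k • w + ((1 / 2 : ℝ) * (t ∘ κ) k ^ 2) • (z ∘ κ) k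
        = x + t (κ k) • u (κ k) := by
      have h2 : (1 / 2 : ℝ) * t (κ k) ^ 2 * (2 / t (κ k)) = t (κ k) := by
        have := (ht (κ k)).ne'
        field_simp
      simp only [Function.comp, hz, smul_smul, h2]
      module
    rw [h1]
    exact hκmem k
  have hvz : -⟪v, z₀⟫ = c := by
    have h1 : Tendsto (fun k => -⟪v, z (κ k)⟫) atTop (𝓝 (-⟪v, z₀⟫)) :=
      (tendsto_const_nhds.inner hzψ).neg
    refine tendsto_nhds_unique h1 (hqκ.congr fun k => ?_)
    have := (ht (κ k)).ne'
    simp only [hz, inner_smul_right, inner_sub_right, hvw]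
    field_simp
    ring
  obtain ⟨ε, hε, ξ, hξmem, hξ0, hξ1, hξ2⟩ := (hder w hcrit).2 z₀ hz₀
  refine ⟨fun t => t⁻¹ • (ξ t - ξ 0), hξ1, ?_, ?_⟩
  · filter_upwards [Ioo_mem_nhdsGT hε] with s hs
    have h1 : x + s • s⁻¹ • (ξ s - ξ 0) = ξ s := by
      rw [smul_inv_smul₀ hs.1.ne', hξ0]
      abel
    rw [h1]
    exact hξmem s ⟨hs.1.le, hs.2.le⟩
  · rw [← hvz]
    have h1 : Tendsto (fun t : ℝ => -⟪v, ((1 / 2 : ℝ) * t ^ 2)⁻¹ • (ξ t - ξ 0 - t • w)⟫) (𝓝[>] 0)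
        (𝓝 (-⟪v, z₀⟫)) := (tendsto_const_nhds.inner hξ2).neg
    refine h1.congr' (eventually_nhdsWithin_of_forall fun s hs => ?_)
    have hs : s ≠ 0 := ne_of_gt hs
    simp only [inner_smul_right, inner_sub_right, hvw]
    field_simp
    ring

/-! ### The squared distance as a Moreau envelope -/

/-- The second-order difference quotient at `x` for `v` of the function
`y ↦ (ρ / 2) (dist(y + ρ⁻¹ v; Θ)² - ‖ρ⁻¹ v‖²)`, the nonsmooth part of the augmented Lagrangian. For
`x ∈ Θ` and `v` normal to `Θ` at `x` this function vanishes at `x`, so its value there does not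
appear. -/
noncomputable def penaltyQuotient (Θ : Set F) (x v : F) (ρ t : ℝ) (u : F) : ℝ :=
  (ρ / 2 * (Metric.infDist (x + t • u + ρ⁻¹ • v) Θ ^ 2 - ‖ρ⁻¹ • v‖ ^ 2) - t * ⟪v, u⟫) /
    (1 / 2 * t ^ 2)

lemma half_mul_norm_sq_sub_norm_sq (x v u w : F) {ρ t : ℝ} (hρ : 0 < ρ) :
    ρ / 2 * (‖x + t • u + ρ⁻¹ • v - (x + t • w)‖ ^ 2 - ‖ρ⁻¹ • v‖ ^ 2) - t * ⟪v, u⟫ =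
      -(t * ⟪v, w⟫) + 1 / 2 * t ^ 2 * (ρ * ‖w - u‖ ^ 2) := by
  have h1 : x + t • u + ρ⁻¹ • v - (x + t • w) = t • (u - w) + ρ⁻¹ • v := by module
  rw [h1, norm_add_sq_real, inner_smul_left, inner_smul_right, real_inner_comm, norm_smul,
    norm_sub_rev w u, mul_pow, Real.norm_eq_abs, sq_abs, inner_sub_right]
  simp only [conj_trivial]
  field_simp
  ring

lemma penaltyQuotient_le {Θ : Set F} {x v u w : F} {ρ t : ℝ} (hρ : 0 < ρ) (ht : 0 < t)
    (hw : x + t • w ∈ Θ) :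
    penaltyQuotient Θ x v ρ t u ≤ -(t * ⟪v, w⟫) / (1 / 2 * t ^ 2) + ρ * ‖w - u‖ ^ 2 := by
  have hd : Metric.infDist (x + t • u + ρ⁻¹ • v) Θ ≤ ‖x + t • u + ρ⁻¹ • v - (x + t • w)‖ := by
    rw [← dist_eq_norm]
    exact Metric.infDist_le_dist_of_mem hw
  have hd2 := pow_le_pow_left₀ Metric.infDist_nonneg hd 2
  have heq := half_mul_norm_sq_sub_norm_sq x v u w (t := t) hρ
  have hpos : 0 < (1 / 2 : ℝ) * t ^ 2 := by positivity
  rw [penaltyQuotient, div_le_iff₀ hpos, add_mul, div_mul_cancel₀ _ hpos.ne']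
  have hm := mul_le_mul_of_nonneg_left hd2 (by positivity : 0 ≤ ρ / 2)
  linarith

/-- The envelope is attained, at the direction towards the projection of `x + t u + ρ⁻¹ v`. -/
lemma exists_penaltyQuotient_eq [ProperSpace F] {Θ : Set F} (hΘ : IsClosed Θ) {x v : F}
    (hx : x ∈ Θ) {ρ t : ℝ} (hρ : 0 < ρ) (ht : 0 < t) (u : F) :
    ∃ w, x + t • w ∈ Θ ∧
      penaltyQuotient Θ x v ρ t u = -(t * ⟪v, w⟫) / (1 / 2 * t ^ 2) + ρ * ‖w - u‖ ^ 2 := by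
  obtain ⟨y, hy, hd⟩ := hΘ.exists_infDist_eq_dist ⟨x, hx⟩ (x + t • u + ρ⁻¹ • v)
  have hyw : x + t • t⁻¹ • (y - x) = y := by rw [smul_inv_smul₀ ht.ne']; abel
  refine ⟨t⁻¹ • (y - x), hyw.symm ▸ hy, ?_⟩
  have hpos : 0 < (1 / 2 : ℝ) * t ^ 2 := by positivity
  have heq := half_mul_norm_sq_sub_norm_sq x v u (t⁻¹ • (y - x)) (t := t) hρ
  rw [hyw] at heq
  rw [penaltyQuotient, hd, dist_eq_norm, heq, add_div, mul_div_cancel_left₀ _ hpos.ne']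

/-! ### Convergence of the envelopes -/

lemma moreauEnvelope_one_div_le {G : Type*} [NormedAddCommGroup G] {ρ : ℝ} (q : G → EReal)
    (u w : G) :
    moreauEnvelope (1 / (2 * ρ)) q u ≤ q w + ((ρ * ‖w - u‖ ^ 2 : ℝ) : EReal) := by
  have h : (1 / (2 * (1 / (2 * ρ))) : ℝ) = ρ := by
    rcases eq_or_ne ρ 0 with rfl | h
    · simp
    · field_simp
  refine (iInf_le _ w).trans_eq ?_
  rw [h]

lemma moreauEnvelope_one_div_lt_iff {G : Type*} [NormedAddCommGroup G] {ρ : ℝ} (q : G → EReal)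
    (u : G) (a : EReal) :
    moreauEnvelope (1 / (2 * ρ)) q u < a ↔ ∃ w, q w + ((ρ * ‖w - u‖ ^ 2 : ℝ) : EReal) < a := by
  have h : (1 / (2 * (1 / (2 * ρ))) : ℝ) = ρ := by
    rcases eq_or_ne ρ 0 with rfl | h
    · simp
    · field_simp
  rw [moreauEnvelope, iInf_lt_iff, h]

lemma moreauEnvelope_secondSubderivative_mem {Θ : Set F} {x v : F} (hx : x ∈ Θ)
    (hv : ∀ y ∈ Θ, ⟪v, y - x⟫ ≤ 0) {ρ : ℝ} (hρ : 0 < ρ) (u : F) :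
    moreauEnvelope (1 / (2 * ρ)) (secondSubderivative (indicatorFn Θ) x v) u ∈
      Icc (0 : EReal) ((ρ * ‖u‖ ^ 2 : ℝ) : EReal) := by
  constructor
  · refine le_iInf fun w => add_nonneg (secondSubderivative_indicatorFn_nonneg hx hv w) ?_
    have : 0 ≤ 1 / (2 * (1 / (2 * ρ))) * ‖w - u‖ ^ 2 := by positivity
    exact_mod_cast this
  · refine (moreauEnvelope_one_div_le _ u 0).trans_eq ?_
    rw [secondSubderivative_indicatorFn_zero hx hv, zero_add, zero_sub, norm_neg]

/-- Lower bound for the envelopes: near-minimizers stay in a fixed ball, on which the definition of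
the lower limit can be applied uniformly by compactness. -/
lemma eventually_lt_penaltyQuotient [ProperSpace F] {Θ : Set F} (hΘ : IsClosed Θ) {x v : F}
    (hx : x ∈ Θ) (hv : ∀ y ∈ Θ, ⟪v, y - x⟫ ≤ 0) {ρ : ℝ} (hρ : 0 < ρ) (u : F) {c : ℝ}
    (hc : (c : EReal) <
      moreauEnvelope (1 / (2 * ρ)) (secondSubderivative (indicatorFn Θ) x v) u) :
    ∀ᶠ p : ℝ × F in 𝓝[>] (0 : ℝ) ×ˢ 𝓝 u, c < penaltyQuotient Θ x v ρ p.1 p.2 := by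
  obtain ⟨R, hR0, hR⟩ : ∃ R : ℝ, 0 < R ∧ c < ρ * R ^ 2 := by
    refine ⟨|c| / ρ + 1, by positivity, ?_⟩
    have h0 : 0 ≤ |c| / ρ := by positivity
    have h1 : ρ * (|c| / ρ) = |c| := by field_simp
    nlinarith [le_abs_self c, mul_nonneg hρ.le (sq_nonneg (|c| / ρ))]
  have hloc : ∀ w ∈ Metric.closedBall u (R + 1),
      ∀ᶠ p : (ℝ × F) × F in (𝓝[>] (0 : ℝ) ×ˢ 𝓝 u) ×ˢ 𝓝 w,
        (c : EReal) < diffQuotient₂ (indicatorFn Θ) x v p.1.1 p.2 +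
          ((ρ * ‖p.2 - p.1.2‖ ^ 2 : ℝ) : EReal) := by
    intro w _
    have h1 : ((c - ρ * ‖w - u‖ ^ 2 : ℝ) : EReal) < secondSubderivative (indicatorFn Θ) x v w := by
      rw [EReal.coe_sub]
      exact EReal.sub_lt_of_lt_add (hc.trans_le (moreauEnvelope_one_div_le _ u w))
    obtain ⟨a, ha, haq⟩ := EReal.lt_iff_exists_real_btwn.1 h1
    have ha : c - ρ * ‖w - u‖ ^ 2 < a := by exact_mod_cast ha
    have h2 : ∀ᶠ p : (ℝ × F) × F in (𝓝[>] (0 : ℝ) ×ˢ 𝓝 u) ×ˢ 𝓝 w,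
        (a : EReal) < diffQuotient₂ (indicatorFn Θ) x v p.1.1 p.2 :=
      ((tendsto_fst.comp tendsto_fst).prodMk tendsto_snd).eventually
        (eventually_lt_of_lt_liminf haq)
    have h3 : Tendsto (fun p : (ℝ × F) × F => ρ * ‖p.2 - p.1.2‖ ^ 2)
        ((𝓝[>] (0 : ℝ) ×ˢ 𝓝 u) ×ˢ 𝓝 w) (𝓝 (ρ * ‖w - u‖ ^ 2)) :=
      ((tendsto_snd.sub (tendsto_snd.comp tendsto_fst)).norm.pow 2).const_mul ρ
    filter_upwards [h2, (tendsto_order.1 h3).1 (c - a) (by linarith)] with p hp1 hp2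
    have h4 : (c : EReal) < ((a + ρ * ‖p.2 - p.1.2‖ ^ 2 : ℝ) : EReal) := by
      exact_mod_cast (by linarith)
    refine h4.trans_le ?_
    rw [EReal.coe_add]
    exact add_le_add_left hp1.le _
  have hunif := eventually_forall_of_isCompact (isCompact_closedBall u (R + 1)) hloc
  filter_upwards [hunif, eventually_pos_fst (𝓝 u),
    tendsto_snd.eventually (Metric.ball_mem_nhds u zero_lt_one)] with p hp hp0 hpu
  obtain ⟨w, hw, heq⟩ := exists_penaltyQuotient_eq hΘ (v := v) hx hρ hp0 p.2
  by_cases hwb : w ∈ Metric.closedBall u (R + 1)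
  · have h1 := hp w hwb
    rw [diffQuotient₂_indicatorFn_of_mem hx hw, ← EReal.coe_add] at h1
    rw [heq]
    exact_mod_cast h1
  · have h1 : R < ‖w - p.2‖ := by
      rw [Metric.mem_closedBall, not_le] at hwb
      have h2 : dist p.2 u < 1 := hpu
      have h3 := dist_triangle w p.2 u
      rw [dist_eq_norm w p.2] at h3
      linarith
    have h2 := hv _ hw
    rw [add_sub_cancel_left, inner_smul_right] at h2
    have h3 : 0 ≤ -(p.1 * ⟪v, w⟫) / (1 / 2 * p.1 ^ 2) := div_nonneg (by linarith) (by positivity)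
    have h4 : ρ * R ^ 2 ≤ ρ * ‖w - p.2‖ ^ 2 := by gcongr
    rw [heq]
    linarith

/-- Upper bound for the envelopes, by a recovery family for a near-minimizer of the limit. -/
lemma eventually_penaltyQuotient_lt [ProperSpace F] {Θ : Set F} {x v : F}
    (hx : x ∈ Θ) (hv : ∀ y ∈ Θ, ⟪v, y - x⟫ ≤ 0)
    (hder : ∀ u ∈ criticalCone Θ x v, ParabolicallyDerivableAt Θ x u)
    (hreg : ParabolicallyRegularAt Θ x v) {ρ : ℝ} (hρ : 0 < ρ) (u : F) {c : ℝ}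
    (hc : moreauEnvelope (1 / (2 * ρ)) (secondSubderivative (indicatorFn Θ) x v) u < (c : EReal)) :
    ∀ᶠ p : ℝ × F in 𝓝[>] (0 : ℝ) ×ˢ 𝓝 u, penaltyQuotient Θ x v ρ p.1 p.2 < c := by
  obtain ⟨w, hw⟩ := (moreauEnvelope_one_div_lt_iff _ _ _).1 hc
  have hbot := (secondSubderivative_indicatorFn_nonneg hx hv w).trans_lt' EReal.bot_lt_zero
  have htop : secondSubderivative (indicatorFn Θ) x v w ≠ ⊤ := by
    intro h
    rw [h, EReal.top_add_coe] at hw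
    exact not_top_lt hw
  obtain ⟨b, hb⟩ : ∃ b : ℝ, secondSubderivative (indicatorFn Θ) x v w = (b : EReal) :=
    ⟨_, (EReal.coe_toReal htop hbot.ne').symm⟩
  rw [hb] at hw
  have hw : b + ρ * ‖w - u‖ ^ 2 < c := by exact_mod_cast hw
  obtain ⟨η, hη, hηmem, hηq⟩ := exists_recovery_family hx hder hreg hb
  have h1 : Tendsto (fun p : ℝ × F =>
      -(p.1 * ⟪v, η p.1⟫) / (1 / 2 * p.1 ^ 2) + ρ * ‖η p.1 - p.2‖ ^ 2)
      (𝓝[>] (0 : ℝ) ×ˢ 𝓝 u) (𝓝 (b + ρ * ‖w - u‖ ^ 2)) :=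
    (hηq.comp tendsto_fst).add ((((hη.comp tendsto_fst).sub tendsto_snd).norm.pow 2).const_mul ρ)
  filter_upwards [(tendsto_order.1 h1).2 c hw, tendsto_fst.eventually hηmem,
    eventually_pos_fst (𝓝 u)] with p hp hmem hp0
  exact (penaltyQuotient_le hρ hp0 hmem).trans_lt hp

/-- The envelopes of the second-order quotients of `δ_Θ` converge continuously to the envelope of
the second subderivative of `δ_Θ`, which is finite. -/
lemma tendsto_penaltyQuotient [ProperSpace F] {Θ : Set F} (hΘ : IsClosed Θ) {x v : F}
    (hx : x ∈ Θ) (hv : ∀ y ∈ Θ, ⟪v, y - x⟫ ≤ 0)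
    (hder : ∀ u ∈ criticalCone Θ x v, ParabolicallyDerivableAt Θ x u)
    (hreg : ParabolicallyRegularAt Θ x v) {ρ : ℝ} (hρ : 0 < ρ) (u : F) :
    ∃ l : ℝ, (l : EReal) =
        moreauEnvelope (1 / (2 * ρ)) (secondSubderivative (indicatorFn Θ) x v) u ∧
      Tendsto (fun p : ℝ × F => penaltyQuotient Θ x v ρ p.1 p.2) (𝓝[>] (0 : ℝ) ×ˢ 𝓝 u) (𝓝 l) := by
  obtain ⟨h0, h1⟩ := moreauEnvelope_secondSubderivative_mem hx hv hρ u
  have hl := EReal.coe_toReal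
    (h1.trans_lt (EReal.coe_lt_top _)).ne (h0.trans_lt' EReal.bot_lt_zero).ne'
  refine ⟨_, hl, tendsto_order.2 ⟨fun c hc => ?_, fun c hc => ?_⟩⟩
  · exact eventually_lt_penaltyQuotient hΘ hx hv hρ u (hl ▸ EReal.coe_lt_coe_iff.2 hc)
  · exact eventually_penaltyQuotient_lt hx hv hder hreg hρ u (hl ▸ EReal.coe_lt_coe_iff.2 hc)

end Cone

/-! ### Second-order expansions of twice differentiable functions -/

section Taylor

variable {E : Type*} [NormedAddCommGroup E] [InnerProductSpace ℝ E]
variable {F : Type*} [NormedAddCommGroup F] [InnerProductSpace ℝ F]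

/-- The second-order Taylor expansion with Peano remainder, by the mean value inequality along the
segments issuing from `x`. -/
lemma TwiceDifferentiableAt.isLittleO_taylor {g : E → F} {x : E} (hg : TwiceDifferentiableAt g x) :
    (fun y => g y - g x - fderiv ℝ g x (y - x) -
        (1 / 2 : ℝ) • fderiv ℝ (fderiv ℝ g) x (y - x) (y - x))
      =o[𝓝 x] fun y => ‖y - x‖ ^ 2 := by
  refine isLittleO_iff.2 fun c hc => ?_
  have h1 := isLittleO_iff.1 hg.2.hasFDerivAt.isLittleO hc
  obtain ⟨δ, hδ, hball⟩ := Metric.eventually_nhds_iff_ball.1 (hg.1.and h1)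
  filter_upwards [Metric.ball_mem_nhds x hδ] with y hy
  set h := y - x with hh
  set A := fderiv ℝ g x
  set B := fderiv ℝ (fderiv ℝ g) x
  have hmem : ∀ s ∈ Icc (0 : ℝ) 1, x + s • h ∈ Metric.ball x δ := by
    intro s hs
    rw [mem_ball_iff_norm] at hy ⊢
    rw [add_sub_cancel_left, norm_smul, Real.norm_of_nonneg hs.1]
    exact (mul_le_of_le_one_left (norm_nonneg _) hs.2).trans_lt hy
  have hderiv : ∀ s ∈ Icc (0 : ℝ) 1,
      HasDerivWithinAt (fun s : ℝ => g (x + s • h) - s • A h - (1 / 2 * s ^ 2) • B h h)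
        ((fderiv ℝ g (x + s • h) - A - B (s • h)) h) (Icc 0 1) s := by
    intro s hs
    have e1 : HasDerivAt (fun s : ℝ => x + s • h) h s := by
      simpa using ((hasDerivAt_id s).smul_const h).const_add x
    have e2 := (hball _ (hmem s hs)).1.hasFDerivAt.comp_hasDerivAt s e1
    have e3 : HasDerivAt (fun s : ℝ => s • A h) (A h) s := by
      simpa using (hasDerivAt_id s).smul_const (A h)
    have e4 : HasDerivAt (fun s : ℝ => (1 / 2 * s ^ 2) • B h h) (s • B h h) s := by
      have := ((hasDerivAt_pow 2 s).const_mul (1 / 2 : ℝ)).smul_const (B h h)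
      convert this using 1
      rw [Nat.cast_ofNat, show 2 - 1 = 1 from rfl, pow_one, one_div, inv_mul_cancel_left₀ two_ne_zero]
    refine (((e2.sub e3).sub e4).congr_deriv ?_).hasDerivWithinAt
    simp
  have hbound : ∀ s ∈ Ico (0 : ℝ) 1,
      ‖(fderiv ℝ g (x + s • h) - A - B (s • h)) h‖ ≤ c * ‖h‖ ^ 2 := by
    intro s hs
    have h2 := (hball _ (hmem s ⟨hs.1, hs.2.le⟩)).2
    rw [add_sub_cancel_left, norm_smul, Real.norm_of_nonneg hs.1] at h2
    calc _ ≤ ‖fderiv ℝ g (x + s • h) - A - B (s • h)‖ * ‖h‖ := ContinuousLinearMap.le_opNorm _ _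
      _ ≤ c * (s * ‖h‖) * ‖h‖ := by gcongr
      _ ≤ c * (1 * ‖h‖) * ‖h‖ := by gcongr; exact hs.2.le
      _ = c * ‖h‖ ^ 2 := by ring
  have key := norm_image_sub_le_of_norm_deriv_le_segment_01' hderiv hbound
  have hxy : x + h = y := by rw [hh]; abel
  rw [norm_pow, norm_norm]
  refine le_of_eq_of_le (congrArg norm ?_) key
  simp only [one_smul, zero_smul, hxy, one_pow, mul_one, add_zero, sub_zero, ne_eq, two_ne_zero,
    not_false_eq_true, zero_pow, mul_zero]
  abel

lemma tendsto_add_smul (x w : E) :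
    Tendsto (fun p : ℝ × E => x + p.1 • p.2) (𝓝[>] (0 : ℝ) ×ˢ 𝓝 w) (𝓝 x) := by
  have h1 : Tendsto (fun p : ℝ × E => p.1) (𝓝[>] (0 : ℝ) ×ˢ 𝓝 w) (𝓝 0) :=
    tendsto_fst.mono_right nhdsWithin_le_nhds
  simpa using (h1.smul tendsto_snd).const_add x

lemma TwiceDifferentiableAt.tendsto_quotient {g : E → ℝ} {x : E} (hg : TwiceDifferentiableAt g x)
    (h0 : fderiv ℝ g x = 0) (w : E) :
    Tendsto (fun p : ℝ × E => (g (x + p.1 • p.2) - g x) / (1 / 2 * p.1 ^ 2))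
      (𝓝[>] (0 : ℝ) ×ˢ 𝓝 w) (𝓝 (fderiv ℝ (fderiv ℝ g) x w w)) := by
  have h1 := hg.isLittleO_taylor.comp_tendsto (tendsto_add_smul x w)
  simp only [h0, Function.comp_def, add_sub_cancel_left, zero_apply, sub_zero,
    smul_eq_mul] at h1
  have h2 : (fun p : ℝ × E => ‖p.1 • p.2‖ ^ 2) =O[𝓝[>] (0 : ℝ) ×ˢ 𝓝 w]
      fun p => 1 / 2 * p.1 ^ 2 := by
    have h3 : (fun p : ℝ × E => ‖p.2‖ ^ 2) =O[𝓝[>] (0 : ℝ) ×ˢ 𝓝 w] fun _ => (1 : ℝ) :=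
      (tendsto_snd.norm.pow 2).isBigO_one ℝ
    have h4 : (fun p : ℝ × E => p.1 ^ 2) =O[𝓝[>] (0 : ℝ) ×ˢ 𝓝 w] fun p => 1 / 2 * p.1 ^ 2 :=
      (isBigO_refl _ _).const_mul_right (by norm_num : (1 / 2 : ℝ) ≠ 0)
    refine (h4.mul h3).congr (fun p => ?_) fun p => by ring
    rw [norm_smul, mul_pow, Real.norm_eq_abs, sq_abs]
  have h5 := (h1.trans_isBigO h2).tendsto_div_nhds_zero
  have h6 : Tendsto (fun p : ℝ × E => fderiv ℝ (fderiv ℝ g) x p.2 p.2) (𝓝[>] (0 : ℝ) ×ˢ 𝓝 w)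
      (𝓝 (fderiv ℝ (fderiv ℝ g) x w w)) := by
    have : Continuous fun v : E => fderiv ℝ (fderiv ℝ g) x v v := by fun_prop
    exact (this.tendsto w).comp tendsto_snd
  have h7 := h5.add h6
  rw [zero_add] at h7
  refine h7.congr' ((eventually_pos_fst (𝓝 w)).mono fun p hp => ?_)
  have hp' : p.1 ≠ 0 := hp.ne'
  simp only [map_smul, smul_apply, smul_eq_mul]
  field_simp
  ring

lemma tendsto_quotient_fderiv {f : E → F} {x : E} (hf : DifferentiableAt ℝ f x) (w : E) :
    Tendsto (fun p : ℝ × E => p.1⁻¹ • (f (x + p.1 • p.2) - f x)) (𝓝[>] (0 : ℝ) ×ˢ 𝓝 w)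
      (𝓝 (fderiv ℝ f x w)) := by
  have h1 := hf.hasFDerivAt.isLittleO.comp_tendsto (tendsto_add_smul x w)
  simp only [Function.comp_def, add_sub_cancel_left] at h1
  have h2 : (fun p : ℝ × E => p.1 • p.2) =O[𝓝[>] (0 : ℝ) ×ˢ 𝓝 w] fun p => p.1 := by
    have h3 : (fun p : ℝ × E => p.2) =O[𝓝[>] (0 : ℝ) ×ˢ 𝓝 w] fun _ => (1 : ℝ) :=
      tendsto_snd.isBigO_one ℝ
    simpa using (isBigO_refl (fun p : ℝ × E => p.1) _).smul h3
  have h5 := (h1.trans_isBigO h2).tendsto_inv_smul_nhds_zero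
  have h6 : Tendsto (fun p : ℝ × E => fderiv ℝ f x p.2) (𝓝[>] (0 : ℝ) ×ˢ 𝓝 w)
      (𝓝 (fderiv ℝ f x w)) := ((fderiv ℝ f x).continuous.tendsto w).comp tendsto_snd
  have h7 := h5.add h6
  rw [zero_add] at h7
  refine h7.congr' ((eventually_pos_fst (𝓝 w)).mono fun p hp => ?_)
  rw [smul_sub, map_smul, inv_smul_smul₀ hp.ne', sub_add_cancel]

lemma TwiceDifferentiableAt.lagrangian {φ : E → ℝ} {f : E → F} {x : E}
    (hφ : TwiceDifferentiableAt φ x) (hf : TwiceDifferentiableAt f x) (μ : F) :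
    TwiceDifferentiableAt (fun y => lagrangian φ f y μ) x := by
  have hd : ∀ᶠ y in 𝓝 x, HasFDerivAt (fun y => VariationalAnalysis.lagrangian φ f y μ)
      (fderiv ℝ φ y + (innerSL ℝ μ).comp (fderiv ℝ f y)) y := by
    filter_upwards [hφ.1, hf.1] with y h1 h2
    exact h1.hasFDerivAt.add ((innerSL ℝ μ).hasFDerivAt.comp y h2.hasFDerivAt)
  refine ⟨hd.mono fun y hy => hy.differentiableAt, ?_⟩
  have h1 : DifferentiableAt ℝ (fun y => fderiv ℝ φ y + (innerSL ℝ μ).comp (fderiv ℝ f y)) x :=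
    hφ.2.add ((differentiableAt_const _).clm_comp hf.2)
  exact h1.congr_of_eventuallyEq (hd.mono fun y hy => hy.fderiv)

end Taylor

/-! ### Convergence of sets -/

/-- Painlevé–Kuratowski convergence, stated with recovery families and with neighbourhoods of the
points outside the limit, implies pointwise convergence of the distance functions in a proper
space. -/
lemma setsConverge_of_proper {X : Type*} [PseudoMetricSpace X] [ProperSpace X] {S : ℝ → Set X}
    {S₀ : Set X} (hclosed : IsClosed S₀)
    (hin : ∀ y ∈ S₀, ∃ s : ℝ → X, Tendsto s (𝓝[>] 0) (𝓝 y) ∧ ∀ᶠ t in 𝓝[>] (0 : ℝ), s t ∈ S t)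
    (hout : ∀ y ∉ S₀, ∀ᶠ p : ℝ × X in 𝓝[>] (0 : ℝ) ×ˢ 𝓝 y, p.2 ∉ S p.1) :
    SetsConverge S S₀ := by
  refine ⟨hclosed, fun p => tendsto_order.2 ⟨fun a ha => ?_, fun a ha => ?_⟩⟩
  · obtain ⟨b, hab, hb⟩ := ENNReal.lt_iff_exists_nnreal_btwn.1 ha
    have hball : ∀ y ∈ Metric.closedBall p b, y ∉ S₀ := by
      intro y hy hyS
      refine (hb.trans_le (Metric.infEDist_le_edist_of_mem hyS)).not_ge ?_
      rw [edist_comm, edist_nndist, ENNReal.coe_le_coe]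
      exact_mod_cast hy
    filter_upwards [eventually_forall_of_isCompact (isCompact_closedBall p b)
      fun y hy => hout y (hball y hy)] with t ht
    refine hab.trans_le (Metric.le_infEDist.2 fun y hy => ?_)
    by_contra! hlt
    refine ht y ?_ hy
    rw [edist_comm, edist_nndist, ENNReal.coe_lt_coe] at hlt
    exact_mod_cast hlt.le
  · obtain ⟨y, hy, hya⟩ := Metric.infEDist_lt_iff.1 ha
    obtain ⟨s, hs, hsS⟩ := hin y hy
    have h1 : Tendsto (fun t => edist p (s t)) (𝓝[>] 0) (𝓝 (edist p y)) :=
      tendsto_const_nhds.edist hs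
    filter_upwards [(tendsto_order.1 h1).2 a hya, hsS] with t h2 h3
    exact (Metric.infEDist_le_edist_of_mem h3).trans_lt h2

section Quotient

/-! ### Functions whose second-order quotients converge continuously -/

variable {E : Type*} [NormedAddCommGroup E] [InnerProductSpace ℝ E]

/-- The second-order quotients `(g(x + t u) - g(x)) / (t² / 2)` converge to `D` continuously, that
is, as `t ↓ 0` and `u → w`, to `D w` for every `w`. -/
def HasSecondOrderLimit (g : E → ℝ) (x : E) (D : E → ℝ) : Prop :=
  ∀ w, Tendsto (fun p : ℝ × E => (g (x + p.1 • p.2) - g x) / (1 / 2 * p.1 ^ 2))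
    (𝓝[>] (0 : ℝ) ×ˢ 𝓝 w) (𝓝 (D w))

namespace HasSecondOrderLimit

variable {g : E → ℝ} {x : E} {D : E → ℝ}

lemma tendsto_first (h : HasSecondOrderLimit g x D) (w : E) :
    Tendsto (fun p : ℝ × E => (g (x + p.1 • p.2) - g x) / p.1) (𝓝[>] (0 : ℝ) ×ˢ 𝓝 w) (𝓝 0) := by
  have h1 : Tendsto (fun p : ℝ × E => p.1) (𝓝[>] (0 : ℝ) ×ˢ 𝓝 w) (𝓝 0) :=
    tendsto_fst.mono_right nhdsWithin_le_nhds
  have h2 := (h1.const_mul (1 / 2)).mul (h w)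
  rw [mul_zero, zero_mul] at h2
  refine h2.congr' ((eventually_pos_fst (𝓝 w)).mono fun p hp => ?_)
  have hp' : p.1 ≠ 0 := hp.ne'
  field_simp

lemma semiderivative_eq_zero (h : HasSecondOrderLimit g x D) (w : E) :
    semiderivative g x w = 0 :=
  (h.tendsto_first w).limUnder_eq

lemma tendsto_semiDiffQuotient₂ (h : HasSecondOrderLimit g x D) (w : E) :
    Tendsto (fun p : ℝ × E => semiDiffQuotient₂ g x p.1 p.2) (𝓝[>] (0 : ℝ) ×ˢ 𝓝 w) (𝓝 (D w)) := by
  simpa [semiDiffQuotient₂, h.semiderivative_eq_zero] using h w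

lemma twiceSemidifferentiableAt (h : HasSecondOrderLimit g x D) : TwiceSemidifferentiableAt g x :=
  ⟨fun w => ⟨0, h.tendsto_first w⟩, fun w => ⟨D w, h.tendsto_semiDiffQuotient₂ w⟩⟩

lemma secondSemiderivative_eq (h : HasSecondOrderLimit g x D) (w : E) :
    secondSemiderivative g x w = D w :=
  (h.tendsto_semiDiffQuotient₂ w).limUnder_eq

lemma tendsto_along (h : HasSecondOrderLimit g x D) (w : E) :
    Tendsto (fun t : ℝ => (g (x + t • w) - g x) / (1 / 2 * t ^ 2)) (𝓝[>] 0) (𝓝 (D w)) := by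
  have h1 : Tendsto (fun t : ℝ => (t, w)) (𝓝[>] 0) (𝓝[>] (0 : ℝ) ×ˢ 𝓝 w) :=
    tendsto_id.prodMk tendsto_const_nhds
  have h2 := (h w).comp h1
  rwa [Function.comp_def] at h2

lemma continuous (h : HasSecondOrderLimit g x D) : Continuous D := by
  refine continuous_iff_continuousAt.2 fun w => Metric.tendsto_nhds.2 fun ε hε => ?_
  obtain ⟨pa, ha, pb, hb, hab⟩ :=
    eventually_prod_iff.1 ((h w).eventually (Metric.ball_mem_nhds _ (half_pos hε)))
  filter_upwards [hb] with v hv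
  have h1 : dist (D v) (D w) ≤ ε / 2 :=
    le_of_tendsto ((h.tendsto_along v).dist tendsto_const_nhds)
      (ha.mono fun t ht => (hab ht hv : dist _ _ < _).le)
  linarith

lemma smul_of_pos (h : HasSecondOrderLimit g x D) {s : ℝ} (hs : 0 < s) (w : E) :
    D (s • w) = s ^ 2 * D w := by
  have h1 : Tendsto (fun t : ℝ => t * s) (𝓝[>] 0) (𝓝[>] 0) := by
    refine tendsto_nhdsWithin_iff.2 ⟨?_, eventually_nhdsWithin_of_forall fun t ht => mul_pos ht hs⟩
    have : Tendsto (fun t : ℝ => t * s) (𝓝 0) (𝓝 (0 * s)) := Continuous.tendsto (by fun_prop) 0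
    simpa using this.mono_left nhdsWithin_le_nhds
  have h2 := ((h.tendsto_along w).comp h1).const_mul (s ^ 2)
  refine tendsto_nhds_unique (h.tendsto_along (s • w)) (h2.congr' ?_)
  refine eventually_nhdsWithin_of_forall fun t ht => ?_
  have ht : t ≠ 0 := ne_of_gt ht
  simp only [Function.comp, smul_smul]
  field_simp

lemma map_zero (h : HasSecondOrderLimit g x D) : D 0 = 0 := by
  refine tendsto_nhds_unique (h.tendsto_along 0) ?_
  simp

/-- Continuous convergence is uniform on the unit sphere, and `D` is positively homogeneous of
degree two. -/
lemma isLittleO [FiniteDimensional ℝ E] (h : HasSecondOrderLimit g x D) :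
    (fun y => g y - (g x + 1 / 2 * D (y - x))) =o[𝓝 x] fun y => ‖y - x‖ ^ 2 := by
  have := FiniteDimensional.proper ℝ E
  refine isLittleO_iff.2 fun c hc => ?_
  have hloc : ∀ w ∈ Metric.sphere (0 : E) 1, ∀ᶠ p : ℝ × E in 𝓝[>] (0 : ℝ) ×ˢ 𝓝 w,
      |(g (x + p.1 • p.2) - g x) / (1 / 2 * p.1 ^ 2) - D p.2| < c := by
    intro w _
    have h1 := (h w).sub ((h.continuous.tendsto w).comp tendsto_snd)
    rw [sub_self] at h1
    simpa using h1.eventually (Metric.ball_mem_nhds 0 hc)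
  have hunif := eventually_forall_of_isCompact (isCompact_sphere (0 : E) 1) hloc
  obtain ⟨δ, hδ, hδ'⟩ := mem_nhdsGT_iff_exists_Ioo_subset.1 hunif
  filter_upwards [Metric.ball_mem_nhds x hδ] with y hy
  rcases eq_or_ne y x with rfl | hyx
  · simp [h.map_zero]
  have ht : 0 < ‖y - x‖ := norm_pos_iff.2 (sub_ne_zero.2 hyx)
  set t := ‖y - x‖ with htdef
  have hv : t⁻¹ • (y - x) ∈ Metric.sphere (0 : E) 1 := by
    rw [mem_sphere_zero_iff_norm, norm_smul, norm_inv, Real.norm_of_nonneg ht.le,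
      inv_mul_cancel₀ ht.ne']
  have h1 := hδ' ⟨ht, mem_ball_iff_norm.1 hy⟩ _ hv
  have hD : D (y - x) = t ^ 2 * D (t⁻¹ • (y - x)) := by
    rw [← h.smul_of_pos ht, smul_inv_smul₀ ht.ne']
  simp only [smul_inv_smul₀ ht.ne', add_sub_cancel] at h1
  rw [hD, Real.norm_eq_abs, Real.norm_of_nonneg (by positivity)]
  have h2 : g y - (g x + 1 / 2 * (t ^ 2 * D (t⁻¹ • (y - x)))) =
      1 / 2 * t ^ 2 * ((g y - g x) / (1 / 2 * t ^ 2) - D (t⁻¹ • (y - x))) := by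
    field_simp
    ring
  rw [h2, abs_mul, abs_of_pos (by positivity)]
  nlinarith [mul_le_mul_of_nonneg_left h1.le (by positivity : 0 ≤ 1 / 2 * t ^ 2),
    mul_pos hc (pow_pos ht 2)]

lemma diffQuotient₂_coe_zero (g : E → ℝ) (x : E) (t : ℝ) (u : E) :
    diffQuotient₂ (fun y => (g y : EReal)) x 0 t u =
      (((g (x + t • u) - g x) / (1 / 2 * t ^ 2) : ℝ) : EReal) := by
  rw [diffQuotient₂, inner_zero_left, mul_zero, EReal.coe_zero, sub_zero, EReal.coe_div,
    EReal.coe_sub]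

lemma secondSubderivative_eq (h : HasSecondOrderLimit g x D) (w : E) :
    secondSubderivative (fun y => (g y : EReal)) x 0 w = (D w : EReal) := by
  simp only [secondSubderivative, diffQuotient₂_coe_zero]
  exact (EReal.tendsto_coe.2 (h w)).liminf_eq

/-- Continuous convergence of finite functions implies convergence of their epigraphs. -/
lemma twiceEpiDifferentiableAt [FiniteDimensional ℝ E] (h : HasSecondOrderLimit g x D) :
    TwiceEpiDifferentiableAt (fun y => (g y : EReal)) x 0 := by
  have : ProperSpace (WithLp 2 (E × ℝ)) := FiniteDimensional.proper ℝ _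
  have hfst : Continuous fun p : WithLp 2 (E × ℝ) => p.fst :=
    continuous_fst.comp (WithLp.prod_continuous_ofLp 2 E ℝ)
  have hsnd : Continuous fun p : WithLp 2 (E × ℝ) => p.snd :=
    continuous_snd.comp (WithLp.prod_continuous_ofLp 2 E ℝ)
  have hepi : epigraph (secondSubderivative (fun y => (g y : EReal)) x 0) =
      {p : WithLp 2 (E × ℝ) | D p.fst ≤ p.snd} := by
    ext p
    simp only [epigraph, h.secondSubderivative_eq, mem_ofPred_eq, EReal.coe_le_coe_iff]
  have hepit : ∀ t (p : WithLp 2 (E × ℝ)),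
      p ∈ epigraph (diffQuotient₂ (fun y => (g y : EReal)) x 0 t) ↔
        (g (x + t • p.fst) - g x) / (1 / 2 * t ^ 2) ≤ p.snd := by
    intro t p
    simp only [epigraph, diffQuotient₂_coe_zero, mem_ofPred_eq, EReal.coe_le_coe_iff]
  rw [TwiceEpiDifferentiableAt, hepi]
  refine setsConverge_of_proper (isClosed_le (h.continuous.comp hfst) hsnd) ?_ ?_
  · intro y hy
    -- The point is lifted, if necessary, to the graph of the quotient above the same base point.
    refine ⟨fun t => WithLp.toLp 2
      (y.fst, max y.snd ((g (x + t • y.fst) - g x) / (1 / 2 * t ^ 2))), ?_, ?_⟩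
    · have h1 : Tendsto (fun t : ℝ => max y.snd ((g (x + t • y.fst) - g x) / (1 / 2 * t ^ 2)))
          (𝓝[>] 0) (𝓝 y.snd) := by
        have := (tendsto_const_nhds (x := y.snd)).max (h.tendsto_along y.fst)
        rwa [max_eq_left hy] at this
      have h2 : Tendsto (fun t : ℝ =>
          (y.fst, max y.snd ((g (x + t • y.fst) - g x) / (1 / 2 * t ^ 2)))) (𝓝[>] 0)
          (𝓝 (y.fst, y.snd)) := tendsto_const_nhds.prodMk_nhds h1
      exact ((WithLp.prod_continuous_toLp 2 E ℝ).tendsto (y.fst, y.snd)).comp h2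
    · exact Eventually.of_forall fun t => (hepit t _).2 (le_max_right _ _)
  · intro y hy
    have h0 : Tendsto (fun p : ℝ × WithLp 2 (E × ℝ) => (p.1, p.2.fst)) (𝓝[>] (0 : ℝ) ×ˢ 𝓝 y)
        (𝓝[>] (0 : ℝ) ×ˢ 𝓝 y.fst) :=
      tendsto_fst.prodMk ((hfst.tendsto y).comp tendsto_snd)
    have h1 : Tendsto (fun p : ℝ × WithLp 2 (E × ℝ) =>
        (g (x + p.1 • p.2.fst) - g x) / (1 / 2 * p.1 ^ 2)) (𝓝[>] (0 : ℝ) ×ˢ 𝓝 y) (𝓝 (D y.fst)) := by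
      have h3 := (h y.fst).comp h0
      rwa [Function.comp_def] at h3
    have h2 : Tendsto (fun p : ℝ × WithLp 2 (E × ℝ) => p.2.snd) (𝓝[>] (0 : ℝ) ×ˢ 𝓝 y)
        (𝓝 y.snd) := (hsnd.tendsto y).comp tendsto_snd
    filter_upwards [h2.eventually_lt h1 (not_le.1 hy)] with p hp
    rw [hepit]
    exact not_le.2 hp

end HasSecondOrderLimit

end Quotient

section AugmentedLagrangian

/-! ### The augmented Lagrangian -/

variable {E : Type*} [NormedAddCommGroup E] [InnerProductSpace ℝ E]
variable {F : Type*} [NormedAddCommGroup F] [InnerProductSpace ℝ F] [ProperSpace F]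

lemma penalty_eq_zero {Θ : Set F} (hΘ : IsClosed Θ) {x v : F}
    (hx : x ∈ Θ) (hv : ∀ y ∈ Θ, ⟪v, y - x⟫ ≤ 0) {ρ : ℝ} (hρ : 0 < ρ) :
    ρ / 2 * (Metric.infDist (x + ρ⁻¹ • v) Θ ^ 2 - ‖ρ⁻¹ • v‖ ^ 2) = 0 := by
  have h1 : penaltyQuotient Θ x v ρ 1 0 ≤ 0 := by
    simpa using penaltyQuotient_le (u := (0 : F)) (w := 0) (v := v) hρ one_pos (by simpa using hx)
  have h2 : 0 ≤ penaltyQuotient Θ x v ρ 1 0 := by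
    obtain ⟨w, hw, heq⟩ := exists_penaltyQuotient_eq hΘ (v := v) hx hρ one_pos 0
    have h3 := hv _ hw
    rw [one_smul, add_sub_cancel_left] at h3
    rw [heq]
    have : 0 ≤ ρ * ‖w - 0‖ ^ 2 := by positivity
    norm_num at this ⊢
    linarith
  have h3 := le_antisymm h1 h2
  rw [penaltyQuotient, smul_zero, inner_zero_right, mul_zero, sub_zero, add_zero] at h3
  simpa using h3

lemma augmentedLagrangian_self {X : Type*} {φ : X → ℝ} {f : X → F} {Θ : Set F}
    (hΘ : IsClosed Θ) {x : X} {μ : F} (hx : f x ∈ Θ) (hμ : ∀ y ∈ Θ, ⟪μ, y - f x⟫ ≤ 0) {ρ : ℝ} (hρ : 0 < ρ) :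
    augmentedLagrangian φ f Θ x μ ρ = φ x := by
  rw [augmentedLagrangian, penalty_eq_zero hΘ hx hμ hρ, add_zero]

/-- The increment of the augmented Lagrangian is that of the Lagrangian plus `t² / 2` times the
envelope of the second-order quotient of `δ_Θ`, taken at the difference quotient of `f`. -/
lemma augmentedLagrangian_quotient_eq {φ : E → ℝ} {f : E → F} {Θ : Set F} (hΘ : IsClosed Θ)
    {x : E} {μ : F} (hx : f x ∈ Θ) (hμ : ∀ y ∈ Θ, ⟪μ, y - f x⟫ ≤ 0) {ρ : ℝ} (hρ : 0 < ρ)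
    {t : ℝ} (ht : 0 < t) (u : E) :
    (augmentedLagrangian φ f Θ (x + t • u) μ ρ - augmentedLagrangian φ f Θ x μ ρ) /
        (1 / 2 * t ^ 2) =
      (lagrangian φ f (x + t • u) μ - lagrangian φ f x μ) / (1 / 2 * t ^ 2) +
        penaltyQuotient Θ (f x) μ ρ t (t⁻¹ • (f (x + t • u) - f x)) := by
  rw [augmentedLagrangian_self hΘ hx hμ hρ, penaltyQuotient, smul_inv_smul₀ ht.ne',
    add_sub_cancel, inner_smul_right, mul_inv_cancel_left₀ ht.ne', inner_sub_right, ← add_div,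
    augmentedLagrangian, lagrangian, lagrangian]
  congr 1
  ring

/-- The second-order quotients of the augmented Lagrangian at a KKT point converge continuously. -/
lemma exists_hasSecondOrderLimit_augmentedLagrangian {φ : E → ℝ} {f : E → F} {Θ : Set F}
    (hΘ : IsClosed Θ) {x : E} {μ : F} (hφ : TwiceDifferentiableAt φ x)
    (hf : TwiceDifferentiableAt f x)
    (hgrad : fderiv ℝ (fun y => lagrangian φ f y μ) x = 0)
    (hx : f x ∈ Θ) (hμ : ∀ y ∈ Θ, ⟪μ, y - f x⟫ ≤ 0)
    (hder : ∀ u ∈ criticalCone Θ (f x) μ, ParabolicallyDerivableAt Θ (f x) u)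
    (hreg : ParabolicallyRegularAt Θ (f x) μ) {ρ : ℝ} (hρ : 0 < ρ) :
    ∃ D : E → ℝ, HasSecondOrderLimit (fun y => augmentedLagrangian φ f Θ y μ ρ) x D ∧
      ∀ w, (D w : EReal) =
        ((fderiv ℝ (fderiv ℝ (fun y => lagrangian φ f y μ)) x w w : ℝ) : EReal) +
          moreauEnvelope (1 / (2 * ρ)) (secondSubderivative (indicatorFn Θ) (f x) μ)
            (fderiv ℝ f x w) := by
  choose l hl hlim using fun u => tendsto_penaltyQuotient hΘ hx hμ hder hreg hρ u
  refine ⟨fun w => fderiv ℝ (fderiv ℝ (fun y => lagrangian φ f y μ)) x w w + l (fderiv ℝ f x w),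
    fun w => ?_, fun w => by rw [EReal.coe_add, hl]⟩
  have h1 := (hφ.lagrangian hf μ).tendsto_quotient hgrad w
  have h2 := (hlim (fderiv ℝ f x w)).comp
    (tendsto_fst.prodMk (tendsto_quotient_fderiv hf.1.self_of_nhds w))
  refine (h1.add h2).congr' ((eventually_pos_fst (𝓝 w)).mono fun p hp => ?_)
  exact (augmentedLagrangian_quotient_eq hΘ hx hμ hρ hp p.2).symm

end AugmentedLagrangian

end VariationalAnalysis

theorem theorem8p3 {n m : ℕ}
    (φ : EuclideanSpace ℝ (Fin n) → ℝ)
    (f : EuclideanSpace ℝ (Fin n) → EuclideanSpace ℝ (Fin m))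
    (Θ : Set (EuclideanSpace ℝ (Fin m)))
    (hΘ_closed : IsClosed Θ) (hΘ_convex : Convex ℝ Θ)
    (xbar : EuclideanSpace ℝ (Fin n)) (lam : EuclideanSpace ℝ (Fin m))
    (hφ : TwiceDifferentiableAt φ xbar) (hf : TwiceDifferentiableAt f xbar)
    -- the KKT system
    (hKKT_grad : gradient (fun x => lagrangian φ f x lam) xbar = 0)
    (hKKT_normal : lam ∈ normalCone Θ (f xbar))
    (hder : ∀ u ∈ criticalCone Θ (f xbar) lam, ParabolicallyDerivableAt Θ (f xbar) u)
    (hreg : ParabolicallyRegularAt Θ (f xbar) lam)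
    (ρ : ℝ) (hρ : 0 < ρ) :
    -- (i) twice semidifferentiability and the formula for the second semiderivative
    (TwiceSemidifferentiableAt (fun x => augmentedLagrangian φ f Θ x lam ρ) xbar ∧
      ∀ w : EuclideanSpace ℝ (Fin n),
        ((secondSemiderivative (fun x => augmentedLagrangian φ f Θ x lam ρ) xbar w : ℝ) : EReal) =
          ((fderiv ℝ (fderiv ℝ (fun x => lagrangian φ f x lam)) xbar w w : ℝ) : EReal) +
          moreauEnvelope (1 / (2 * ρ)) (secondSubderivative (indicatorFn Θ) (f xbar) lam)
            (fderiv ℝ f xbar w)) ∧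
    -- (ii) the second-order expansion
    ((fun x => augmentedLagrangian φ f Θ x lam ρ -
        (φ xbar + 1 / 2 *
          secondSemiderivative (fun x' => augmentedLagrangian φ f Θ x' lam ρ) xbar (x - xbar)))
      =o[𝓝 xbar] fun x => ‖x - xbar‖ ^ 2) ∧
    -- (iii) twice epi-differentiability for `0` and the second subderivative
    (TwiceEpiDifferentiableAt
        (fun x => ((augmentedLagrangian φ f Θ x lam ρ : ℝ) : EReal)) xbar 0 ∧
      ∀ w : EuclideanSpace ℝ (Fin n),
        secondSubderivative
            (fun x => ((augmentedLagrangian φ f Θ x lam ρ : ℝ) : EReal)) xbar 0 w =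
          ((secondSemiderivative
              (fun x => augmentedLagrangian φ f Θ x lam ρ) xbar w : ℝ) : EReal)) := by
  have hx : f xbar ∈ Θ := hKKT_normal.1
  have hμ : ∀ y ∈ Θ, ⟪lam, y - f xbar⟫ ≤ 0 := fun y hy =>
    inner_sub_nonpos_of_mem_normalCone hΘ_convex hKKT_normal hy
  have hgrad : fderiv ℝ (fun x => lagrangian φ f x lam) xbar = 0 := by
    simpa [gradient] using hKKT_grad
  obtain ⟨D, hD, hDeq⟩ := exists_hasSecondOrderLimit_augmentedLagrangian hΘ_closed hφ hf hgrad hx hμ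
    hder hreg hρ
  refine ⟨⟨hD.twiceSemidifferentiableAt, fun w => ?_⟩, ?_, hD.twiceEpiDifferentiableAt, fun w => ?_⟩
  · rw [hD.secondSemiderivative_eq, hDeq]
  · simpa only [hD.secondSemiderivative_eq, augmentedLagrangian_self hΘ_closed hx hμ hρ] using
      hD.isLittleO
  · rw [hD.secondSubderivative_eq, hD.secondSemiderivative_eq]
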